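/- All graphs are finite and simple, and $\overline G$ denotes the complement of $G$. For a graph $G$ let $\mathcal I^2_{\rm J}(G)$ be the token-jumping graph: its vertices are the independent sets of $G$ of size $2$, and two of them, $I$ and $J$, are adjacent if $J=(I\setminus\{u\})\cup\{v\}$ for some $u\in I$ and $v\notin I$. Let $\mathcal G$ be the class of graphs $G$ such that, whenever $G$ is the complete join of two graphs $G_1,G_2$ with non-empty vertex sets, both $G_1$ and $G_2$ contain an independent set of size $2$. Let $G\in\mathcal G$ be such that $\mathcal I^2_{\rm J}(G)$ is connected (in particular, it has at least one vertex). Then $G$ is determined within $\mathcal G$ by $\mathcal I^2_{\rm J}(G)$, that is, every $H\in\mathcal G$ with $\mathcal I^2_{\rm J}(H)\cong\mathcal I^2_{\rm J}(G)$ satisfies $H\cong G$, if and only if it is not the case that $\mathcal I^2_{\rm J}(G)$ is a triangle $K_3$ and $\overline G$ is isomorphic to $K_3$ or to the claw $K_{1,3}$. -/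

import Mathlib

/-- The token-jumping reconfiguration graph: its vertices are the independent sets of size `k`
of `G`; `I` and `J` are adjacent when `J` arises from `I` by moving one token from a vertex
`u ∈ I` to some vertex `v ∉ I`. -/
def tokenJumpingGraph {V : Type*} (k : ℕ) (G : SimpleGraph V) :
    SimpleGraph {I : Finset V // G.IsNIndepSet k I} where
  Adj I J := ∃ u ∈ I.1, ∃ v ∉ I.1, (J.1 : Set V) = insert v ((I.1 : Set V) \ {u})
  symm := ⟨by
    rintro I J ⟨u, hu, v, hv, h⟩
    have hvu : v ≠ u := fun e => hv (e ▸ hu)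
    have mem : ∀ x, x ∈ J.1 ↔ x = v ∨ (x ∈ I.1 ∧ x ≠ u) := fun x => by
      simpa using Set.ext_iff.1 h x
    refine ⟨v, (mem v).2 (Or.inl rfl), u, fun hm => ?_, ?_⟩
    · rcases (mem u).1 hm with e | e
      · exact hvu e.symm
      · exact e.2 rfl
    · ext x
      simp only [Set.mem_insert_iff, Set.mem_sdiff, Set.mem_singleton_iff, Finset.mem_coe, mem]
      constructor
      · intro hx
        by_cases hxu : x = u
        · exact Or.inl hxu
        · exact Or.inr ⟨Or.inr ⟨hx, hxu⟩, fun e => hv (e ▸ hx)⟩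
      · rintro (rfl | ⟨e | e, hne⟩)
        · exact hu
        · exact absurd e hne
        · exact e.1⟩
  loopless := ⟨by
    rintro I ⟨u, hu, v, hv, h⟩
    have hm : v ∈ (I.1 : Set V) := by rw [h]; exact Set.mem_insert _ _
    exact hv hm⟩

/-- Whenever `G` is the complete join of two subgraphs, induced by complementary non-empty vertex
sets `A` and `B`, both of these contain an independent set of size `k`. -/
def JoinFactorsHaveIndepSets {V : Type*} (k : ℕ) (G : SimpleGraph V) : Prop :=
  ∀ A B : Set V, A.Nonempty → B.Nonempty → IsCompl A B → (∀ a ∈ A, ∀ b ∈ B, G.Adj a b) →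
    (∃ I : Finset V, (I : Set V) ⊆ A ∧ G.IsNIndepSet k I) ∧
    (∃ I : Finset V, (I : Set V) ⊆ B ∧ G.IsNIndepSet k I)

/-- Among the finite graphs satisfying `JoinFactorsHaveIndepSets k`, `G` is determined up to
isomorphism by the isomorphism type of its token-jumping graph. (Every finite graph has an
isomorphic copy in `Type`, so no graph `H` is lost by the choice of universe.) -/
def DeterminedByTokenJumpingGraph {V : Type*} (k : ℕ) (G : SimpleGraph V) : Prop :=
  ∀ (W : Type) [Finite W] (H : SimpleGraph W), JoinFactorsHaveIndepSets k H →
    Nonempty (tokenJumpingGraph k H ≃g tokenJumpingGraph k G) → Nonempty (H ≃g G)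

/-!
For two tokens, the token-jumping graph of `G` is the line graph of the complement of `G`
(`nonempty_tokenJumpingGraph_iso_lineGraph`), and the condition on joins says that the complement
has no isolated vertex, except possibly when it has no edge at all. The statement is therefore
Whitney's theorem on line graphs (`nonempty_iso_of_lineGraph_iso`), together with the fact that the
triangle and the claw have the same line graph.

Whitney's theorem is proved as follows. Let `φ` be an isomorphism between the line graphs of `X`
and `Y`. Three pairwise meeting edges form a claw or a triangle.

* If `φ` turns no claw into a triangle, in either direction, then it maps the star of each vertex
  onto a star (`exists_star`). As a vertex is determined by its star, once there are at least two
  edges (`eq_of_star_eq`), this gives a bijection between the vertices, and it preserves adjacency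
  because two distinct vertices are adjacent exactly when their stars intersect
  (`nonempty_iso_of_preserves_claws`).
* If `φ` turns a claw with leaves `a`, `b`, `c` into a triangle, then any further edge meeting the
  triangle meets exactly two of its sides, so any further edge meeting the claw joins two leaves
  (`edge_cases_of_claw_to_triangle`). Hence `X` is the claw plus some edges between leaves, while
  `Y` is the triangle plus as many edges to a single fourth vertex. If there is no further edge,
  `X` is the claw and `Y` the triangle; otherwise `X` and `Y` are isomorphic, even though `φ` is not
  induced by an isomorphism (`nonempty_iso_or_claw_of_claw_to_triangle`).
-/

open SimpleGraph

/-! ### Edges as two-element sets -/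

/-- Two unordered pairs meet if they have a common element. Unlike adjacency in the line graph,
this includes the case of equal pairs. -/
def Meets {V : Type*} (e f : Sym2 V) : Prop := ∃ u, u ∈ e ∧ u ∈ f

lemma meets_self {V : Type*} (e : Sym2 V) : Meets e e := by
  induction e with
  | _ a b => exact ⟨a, by simp, by simp⟩

@[simp] lemma meets_mk {V : Type*} {a b : V} {e : Sym2 V} :
    Meets e s(a, b) ↔ a ∈ e ∨ b ∈ e := by
  simp only [Meets, Sym2.mem_iff]
  constructor
  · rintro ⟨u, h, rfl | rfl⟩ <;> tauto
  · rintro (h | h)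
    exacts [⟨a, h, .inl rfl⟩, ⟨b, h, .inr rfl⟩]

lemma eq_of_mem_of_mem {V : Type*} {e f : Sym2 V} (h : e ≠ f) {x y : V} (hxe : x ∈ e) (hxf : x ∈ f)
    (hye : y ∈ e) (hyf : y ∈ f) : x = y := by
  by_contra hxy
  exact h (((Sym2.mem_and_mem_iff hxy).1 ⟨hxe, hye⟩).trans
    ((Sym2.mem_and_mem_iff hxy).1 ⟨hxf, hyf⟩).symm)

/-- Three pairwise meeting pairs without a common element are the sides of a triangle. -/
lemma exists_triangle {V : Type*} {e f g : Sym2 V} (hef : Meets e f) (heg : Meets e g)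
    (hfg : Meets f g) (h : ¬ ∃ u, u ∈ e ∧ u ∈ f ∧ u ∈ g) :
    ∃ x y z, x ≠ y ∧ x ≠ z ∧ y ≠ z ∧ e = s(y, z) ∧ f = s(x, z) ∧ g = s(x, y) := by
  obtain ⟨x, hxf, hxg⟩ := hfg
  obtain ⟨y, hye, hyg⟩ := heg
  obtain ⟨z, hze, hzf⟩ := hef
  have hxy : x ≠ y := by rintro rfl; exact h ⟨x, hye, hxf, hxg⟩
  have hxz : x ≠ z := by rintro rfl; exact h ⟨x, hze, hxf, hxg⟩
  have hyz : y ≠ z := by rintro rfl; exact h ⟨y, hye, hzf, hyg⟩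
  exact ⟨x, y, z, hxy, hxz, hyz, (Sym2.mem_and_mem_iff hyz).1 ⟨hye, hze⟩,
    (Sym2.mem_and_mem_iff hxz).1 ⟨hxf, hzf⟩, (Sym2.mem_and_mem_iff hxy).1 ⟨hxg, hyg⟩⟩

/-- A pair that meets a triangle is a side of it or leaves it at exactly one corner. -/
lemma side_or_pendant_of_meets_triangle {V : Type*} {x y z : V} {e : Sym2 V} (he : ¬ e.IsDiag)
    (h : x ∈ e ∨ y ∈ e ∨ z ∈ e) :
    (e = s(y, z) ∨ e = s(x, z) ∨ e = s(x, y)) ∨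
      ∃ t ∉ ({x, y, z} : Set V), e = s(x, t) ∨ e = s(y, t) ∨ e = s(z, t) := by
  induction e with
  | _ a b => grind [Sym2.eq_swap, Sym2.mk_isDiag_iff]

lemma meets_iso {V W : Type*} {X : SimpleGraph V} {Y : SimpleGraph W}
    (φ : X.lineGraph ≃g Y.lineGraph) (e f : X.edgeSet) :
    Meets (φ e : Sym2 W) (φ f : Sym2 W) ↔ Meets (e : Sym2 V) (f : Sym2 V) := by
  by_cases hef : e = f
  · subst hef
    exact iff_of_true (meets_self _) (meets_self _)
  · have h := φ.map_adj_iff (v := e) (w := f)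
    rw [lineGraph_adj_iff_exists, lineGraph_adj_iff_exists] at h
    simpa [hef, Meets] using h

/-! ### Explicit isomorphisms -/

/-- A bijection onto the vertices that transports adjacency is an isomorphism. -/
lemma nonempty_iso_of_bijective {V W ι : Type*} {X : SimpleGraph V} {Y : SimpleGraph W}
    {α : ι → V} {β : ι → W} (hα : α.Bijective) (hβ : β.Bijective)
    (h : ∀ i j, X.Adj (α i) (α j) ↔ Y.Adj (β i) (β j)) : Nonempty (X ≃g Y) :=
  ⟨{ toEquiv := (Equiv.ofBijective α hα).symm.trans (Equiv.ofBijective β hβ)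
     map_rel_iff' := by
      intro a b
      obtain ⟨i, rfl⟩ := hα.2 a
      obtain ⟨j, rfl⟩ := hα.2 b
      simp [h, Equiv.ofBijective_symm_apply_apply] }⟩

lemma nonempty_iso_of_four {V W : Type*} {X : SimpleGraph V} {Y : SimpleGraph W}
    {a b c d : V} {x y z w : W} (hV : [a, b, c, d].Nodup) (hW : [x, y, z, w].Nodup)
    (hV' : ∀ u, u ∈ [a, b, c, d]) (hW' : ∀ u, u ∈ [x, y, z, w])
    (hab : X.Adj a b ↔ Y.Adj x y) (hac : X.Adj a c ↔ Y.Adj x z) (had : X.Adj a d ↔ Y.Adj x w)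
    (hbc : X.Adj b c ↔ Y.Adj y z) (hbd : X.Adj b d ↔ Y.Adj y w) (hcd : X.Adj c d ↔ Y.Adj z w) :
    Nonempty (X ≃g Y) := by
  refine nonempty_iso_of_bijective (α := [a, b, c, d].get) (β := [x, y, z, w].get)
    ⟨List.nodup_iff_injective_get.1 hV, fun u => List.get_of_mem (hV' u)⟩
    ⟨List.nodup_iff_injective_get.1 hW, fun u => List.get_of_mem (hW' u)⟩ fun i j => ?_
  simp only [List.length_cons, List.length_nil] at i j
  fin_cases i <;> fin_cases j <;> simp [hab, hac, had, hbc, hbd, hcd] <;>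
    simpa only [adj_comm] using by assumption

lemma nonempty_iso_claw {V : Type*} {X : SimpleGraph V} {v a b c : V}
    (hV : ∀ u, u = v ∨ u = a ∨ u = b ∨ u = c) (hab : a ≠ b) (hac : a ≠ c) (hbc : b ≠ c)
    (hva : X.Adj v a) (hvb : X.Adj v b) (hvc : X.Adj v c) (hnab : ¬ X.Adj a b)
    (hnac : ¬ X.Adj a c) (hnbc : ¬ X.Adj b c) :
    Nonempty (X ≃g completeBipartiteGraph (Fin 1) (Fin 3)) := by
  have hnba : ¬ X.Adj b a := fun h => hnab h.symm
  have hnca : ¬ X.Adj c a := fun h => hnac h.symm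
  have hncb : ¬ X.Adj c b := fun h => hnbc h.symm
  refine nonempty_iso_of_bijective (α := Sum.elim (fun _ => v) ![a, b, c]) ⟨?_, fun u => ?_⟩
    Function.bijective_id ?_
  · rintro (i | i) (j | j) <;> fin_cases i <;> fin_cases j <;>
      simp [hva.ne, hvb.ne, hvc.ne, hva.ne', hvb.ne', hvc.ne', hab, hac, hbc, hab.symm,
        hac.symm, hbc.symm]
  · rcases hV u with rfl | rfl | rfl | rfl
    exacts [⟨.inl 0, rfl⟩, ⟨.inr 0, rfl⟩, ⟨.inr 1, rfl⟩, ⟨.inr 2, rfl⟩]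
  · rintro (i | i) (j | j) <;> fin_cases i <;> fin_cases j <;>
      simp [hva, hvb, hvc, hva.symm, hvb.symm, hvc.symm, hnab, hnac, hnbc, hnba, hnca, hncb]

lemma nonempty_iso_triangle {V : Type*} {X : SimpleGraph V} {x y z : V}
    (hV : ∀ u, u ∈ [x, y, z]) (hxy : X.Adj x y) (hxz : X.Adj x z) (hyz : X.Adj y z) :
    Nonempty (X ≃g (⊤ : SimpleGraph (Fin 3))) := by
  refine nonempty_iso_of_bijective (α := [x, y, z].get) ⟨List.nodup_iff_injective_get.1 ?_,
    fun u => List.get_of_mem (hV u)⟩ Function.bijective_id ?_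
  · simp [hxy.ne, hxz.ne, hyz.ne]
  · intro i j
    simp only [List.length_cons, List.length_nil] at i j
    fin_cases i <;> fin_cases j <;> simp [hxy, hxz, hyz, hxy.symm, hxz.symm, hyz.symm]

lemma nonempty_iso_edge {V : Type*} {X : SimpleGraph V} {x y : V}
    (hV : ∀ u, u = x ∨ u = y) (hxy : X.Adj x y) : Nonempty (X ≃g (⊤ : SimpleGraph (Fin 2))) := by
  refine nonempty_iso_of_bijective (α := ![x, y]) ⟨fun i j => ?_, fun u => ?_⟩
    Function.bijective_id fun i j => ?_
  · fin_cases i <;> fin_cases j <;> simp [hxy.ne, hxy.ne']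
  · rcases hV u with rfl | rfl
    exacts [⟨0, rfl⟩, ⟨1, rfl⟩]
  · fin_cases i <;> fin_cases j <;> simp [hxy, hxy.symm]

/-! ### Claws that become triangles -/

/-- A property of edges that passes to every edge meeting a given one holds for all edges as soon
as it holds for one, if the line graph is connected. -/
lemma edge_induction {V : Type*} {X : SimpleGraph V} (hX : X.lineGraph.Preconnected)
    {P : X.edgeSet → Prop} (e₀ : X.edgeSet) (h₀ : P e₀)
    (h : ∀ e f : X.edgeSet, P e → Meets (e : Sym2 V) f → P f) (e : X.edgeSet) : P e := by
  obtain ⟨p⟩ := hX e₀ e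
  induction p with
  | nil => exact h₀
  | cons hadj _ ih =>
    exact ih (h _ _ h₀ (lineGraph_adj_iff_exists.1 hadj).2)

/-- If an isomorphism of line graphs turns the claw with centre `v` and leaves `a`, `b`, `c` into
the triangle `x y z`, then every edge of the first graph lies in `{v, a, b, c}`, and an edge joining
two leaves is sent to an edge that leaves the triangle at the corresponding corner. The reason is
that an edge meeting a triangle without being a side of it meets exactly two of the sides. -/
lemma edge_cases_of_claw_to_triangle {V W : Type*} {X : SimpleGraph V} {Y : SimpleGraph W}
    (hX : X.lineGraph.Preconnected) (φ : X.lineGraph ≃g Y.lineGraph) {v a b c : V} {x y z : W}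
    (hab : a ≠ b) (hac : a ≠ c) (hbc : b ≠ c) {e₁ e₂ e₃ : X.edgeSet}
    (he₁ : (e₁ : Sym2 V) = s(v, a)) (he₂ : (e₂ : Sym2 V) = s(v, b)) (he₃ : (e₃ : Sym2 V) = s(v, c))
    (hxy : x ≠ y) (hxz : x ≠ z) (hyz : y ≠ z)
    (hf₁ : (φ e₁ : Sym2 W) = s(y, z)) (hf₂ : (φ e₂ : Sym2 W) = s(x, z))
    (hf₃ : (φ e₃ : Sym2 W) = s(x, y)) (e : X.edgeSet) :
    (e = e₁ ∨ e = e₂ ∨ e = e₃) ∨ ∃ t ∉ ({x, y, z} : Set W),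
      (((e : Sym2 V) = s(a, b) ∧ (φ e : Sym2 W) = s(z, t)) ∨
       ((e : Sym2 V) = s(b, c) ∧ (φ e : Sym2 W) = s(x, t)) ∨
       ((e : Sym2 V) = s(a, c) ∧ (φ e : Sym2 W) = s(y, t))) := by
  have key : ∀ e : X.edgeSet, (v ∈ (e : Sym2 V) ∨ a ∈ (e : Sym2 V) ∨ b ∈ (e : Sym2 V) ∨
      c ∈ (e : Sym2 V)) → (e = e₁ ∨ e = e₂ ∨ e = e₃) ∨ ∃ t ∉ ({x, y, z} : Set W),
      (((e : Sym2 V) = s(a, b) ∧ (φ e : Sym2 W) = s(z, t)) ∨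
       ((e : Sym2 V) = s(b, c) ∧ (φ e : Sym2 W) = s(x, t)) ∨
       ((e : Sym2 V) = s(a, c) ∧ (φ e : Sym2 W) = s(y, t))) := by
    intro e he
    have m₁ := meets_iso φ e e₁
    have m₂ := meets_iso φ e e₂
    have m₃ := meets_iso φ e e₃
    rw [he₁, hf₁, meets_mk, meets_mk] at m₁
    rw [he₂, hf₂, meets_mk, meets_mk] at m₂
    rw [he₃, hf₃, meets_mk, meets_mk] at m₃
    have hmeet : x ∈ (φ e : Sym2 W) ∨ y ∈ (φ e : Sym2 W) ∨ z ∈ (φ e : Sym2 W) := by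
      rcases he with he | he | he | he
      · exact .inr (m₁.2 (.inl he))
      · exact .inr (m₁.2 (.inr he))
      · exact (m₂.2 (.inr he)).imp_right .inr
      · exact (m₃.2 (.inr he)).imp_right .inl
    rcases side_or_pendant_of_meets_triangle (Y.not_isDiag_of_mem_edgeSet (φ e).2) hmeet with
      (h | h | h) | ⟨t, ht, h⟩
    · exact .inl (.inl (φ.injective (Subtype.ext (h.trans hf₁.symm))))
    · exact .inl (.inr (.inl (φ.injective (Subtype.ext (h.trans hf₂.symm)))))
    · exact .inl (.inr (.inr (φ.injective (Subtype.ext (h.trans hf₃.symm)))))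
    · refine .inr ⟨t, ht, ?_⟩
      simp only [Set.mem_insert_iff, Set.mem_singleton_iff, not_or] at ht
      obtain ⟨htx, hty, htz⟩ := ht
      rcases h with h | h | h
      · have hx : x ∈ (φ e : Sym2 W) := by simp [h]
        have hy : y ∉ (φ e : Sym2 W) := by simp [h, hxy.symm, Ne.symm hty]
        have hz : z ∉ (φ e : Sym2 W) := by simp [h, hxz.symm, Ne.symm htz]
        simp [hx, hy, hz] at m₁ m₂ m₃
        exact .inr (.inl ⟨
          (Sym2.mem_and_mem_iff hbc).1 ⟨m₂.resolve_left m₁.1, m₃.resolve_left m₁.1⟩, h⟩)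
      · have hx : x ∉ (φ e : Sym2 W) := by simp [h, hxy, Ne.symm htx]
        have hy : y ∈ (φ e : Sym2 W) := by simp [h]
        have hz : z ∉ (φ e : Sym2 W) := by simp [h, hyz.symm, Ne.symm htz]
        simp [hx, hy, hz] at m₁ m₂ m₃
        exact .inr (.inr ⟨
          (Sym2.mem_and_mem_iff hac).1 ⟨m₁.resolve_left m₂.1, m₃.resolve_left m₂.1⟩, h⟩)
      · have hx : x ∉ (φ e : Sym2 W) := by simp [h, hxz, Ne.symm htx]
        have hy : y ∉ (φ e : Sym2 W) := by simp [h, hyz, Ne.symm hty]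
        have hz : z ∈ (φ e : Sym2 W) := by simp [h]
        simp [hx, hy, hz] at m₁ m₂ m₃
        exact .inl ⟨
          (Sym2.mem_and_mem_iff hab).1 ⟨m₁.resolve_left m₃.1, m₂.resolve_left m₃.1⟩, h⟩
  refine key e (edge_induction (P := fun e => v ∈ (e : Sym2 V) ∨ a ∈ (e : Sym2 V) ∨
    b ∈ (e : Sym2 V) ∨ c ∈ (e : Sym2 V)) hX e₁ (by simp [he₁]) (fun e f he hef => ?_) e)
  obtain ⟨u, hue, huf⟩ := hef
  have : u = v ∨ u = a ∨ u = b ∨ u = c := by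
    rcases key e he with (rfl | rfl | rfl) | ⟨t, -, h | h | h⟩
    · rw [he₁, Sym2.mem_iff] at hue; tauto
    · rw [he₂, Sym2.mem_iff] at hue; tauto
    · rw [he₃, Sym2.mem_iff] at hue; tauto
    all_goals rw [h.1, Sym2.mem_iff] at hue; tauto
  rcases this with rfl | rfl | rfl | rfl <;> tauto

/-- The complete graphs on `{v, a, b, c}` and on `{x, y, z, w}` stay isomorphic if some of the sides
of the triangle `a b c` are removed from the first, and as many of the edges at `w`, but not all,
from the second. -/
lemma nonempty_iso_of_claw_of_triangle {V W : Type*} {X : SimpleGraph V} {Y : SimpleGraph W}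
    {v a b c : V} {x y z w : W} (hV : ∀ u, u = v ∨ u = a ∨ u = b ∨ u = c)
    (hW : ∀ u, u = x ∨ u = y ∨ u = z ∨ u = w) (hab : a ≠ b) (hac : a ≠ c) (hbc : b ≠ c)
    (hva : X.Adj v a) (hvb : X.Adj v b) (hvc : X.Adj v c) (hxy : Y.Adj x y) (hxz : Y.Adj x z)
    (hyz : Y.Adj y z) (hwx : w ≠ x) (hwy : w ≠ y) (hwz : w ≠ z) (hzw : X.Adj a b ↔ Y.Adj z w)
    (hxw : X.Adj b c ↔ Y.Adj x w) (hyw : X.Adj a c ↔ Y.Adj y w)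
    (h : Y.Adj x w ∨ Y.Adj y w ∨ Y.Adj z w) : Nonempty (X ≃g Y) := by
  have hnodup : [v, a, b, c].Nodup := by
    simp [hva.ne, hvb.ne, hvc.ne, hab, hac, hbc]
  have iso := fun {p q r s : W} (hW₁ : [p, q, r, s].Nodup) (hW₂ : ∀ u, u ∈ [p, q, r, s]) =>
    nonempty_iso_of_four (X := X) (Y := Y) hnodup hW₁ (by simpa using hV) hW₂
  have hwx' : Y.Adj w x ↔ Y.Adj x w := Y.adj_comm w x
  have hwy' : Y.Adj w y ↔ Y.Adj y w := Y.adj_comm w y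
  have hwz' : Y.Adj w z ↔ Y.Adj z w := Y.adj_comm w z
  -- `v` goes to a corner joined to all vertices. With one edge `w p` missing, the two ends of the
  -- missing leaf edge go to `w` and `p`; with two missing, the common end of the missing leaf edges
  -- goes to `w`. The last case, with no edge at `w`, is excluded.
  by_cases h₁ : Y.Adj x w <;> by_cases h₂ : Y.Adj y w <;> by_cases h₃ : Y.Adj z w <;>
    [refine iso (p := x) (q := y) (r := z) (s := w) ?_ ?_ ?_ ?_ ?_ ?_ ?_ ?_;
     refine iso (p := y) (q := z) (r := w) (s := x) ?_ ?_ ?_ ?_ ?_ ?_ ?_ ?_;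
     refine iso (p := x) (q := y) (r := z) (s := w) ?_ ?_ ?_ ?_ ?_ ?_ ?_ ?_;
     refine iso (p := x) (q := w) (r := y) (s := z) ?_ ?_ ?_ ?_ ?_ ?_ ?_ ?_;
     refine iso (p := y) (q := z) (r := x) (s := w) ?_ ?_ ?_ ?_ ?_ ?_ ?_ ?_;
     refine iso (p := y) (q := x) (r := w) (s := z) ?_ ?_ ?_ ?_ ?_ ?_ ?_ ?_;
     refine iso (p := z) (q := x) (r := y) (s := w) ?_ ?_ ?_ ?_ ?_ ?_ ?_ ?_;
     exact absurd h (by simp [h₁, h₂, h₃])] <;>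
    first
    | (intro u
       rcases hW u with rfl | rfl | rfl | rfl <;> simp)
    | simp [hxy.ne, hxz.ne, hyz.ne, hxy.ne', hxz.ne', hyz.ne', hwx, hwy, hwz, hwx.symm, hwy.symm,
        hwz.symm]
    | simp [hva, hvb, hvc, hzw, hxw, hyw, hwx', hwy', hwz', h₁, h₂, h₃, hxy, hxz, hyz, hxy.symm,
        hxz.symm, hyz.symm]

/-- A claw that an isomorphism of line graphs turns into a triangle forces both graphs to have at
most four vertices: either they are the claw and the triangle themselves, or they are isomorphic. -/
lemma nonempty_iso_or_claw_of_claw_to_triangle {V W : Type*} {X : SimpleGraph V}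
    {Y : SimpleGraph W} (hX₀ : ∀ u, ∃ u', X.Adj u u') (hY₀ : ∀ u, ∃ u', Y.Adj u u')
    (hX : X.lineGraph.Preconnected) (φ : X.lineGraph ≃g Y.lineGraph) {v : V} {e₁ e₂ e₃ : X.edgeSet}
    (h₁ : v ∈ (e₁ : Sym2 V)) (h₂ : v ∈ (e₂ : Sym2 V)) (h₃ : v ∈ (e₃ : Sym2 V))
    (h : ¬ ∃ w, w ∈ (φ e₁ : Sym2 W) ∧ w ∈ (φ e₂ : Sym2 W) ∧ w ∈ (φ e₃ : Sym2 W)) :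
    Nonempty (X ≃g Y) ∨ (Nonempty (X ≃g completeBipartiteGraph (Fin 1) (Fin 3)) ∧
      Nonempty (Y ≃g (⊤ : SimpleGraph (Fin 3)))) := by
  obtain ⟨x, y, z, hxy, hxz, hyz, hf₁, hf₂, hf₃⟩ := exists_triangle
    ((meets_iso φ e₁ e₂).2 ⟨v, h₁, h₂⟩) ((meets_iso φ e₁ e₃).2 ⟨v, h₁, h₃⟩)
    ((meets_iso φ e₂ e₃).2 ⟨v, h₂, h₃⟩) h
  obtain ⟨a, he₁⟩ := Sym2.mem_iff_exists.1 h₁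
  obtain ⟨b, he₂⟩ := Sym2.mem_iff_exists.1 h₂
  obtain ⟨c, he₃⟩ := Sym2.mem_iff_exists.1 h₃
  have hva : X.Adj v a := by simpa [he₁] using e₁.2
  have hvb : X.Adj v b := by simpa [he₂] using e₂.2
  have hvc : X.Adj v c := by simpa [he₃] using e₃.2
  have hYyz : Y.Adj y z := by simpa [hf₁] using (φ e₁).2
  have hYxz : Y.Adj x z := by simpa [hf₂] using (φ e₂).2
  have hYxy : Y.Adj x y := by simpa [hf₃] using (φ e₃).2
  have hab : a ≠ b := by
    rintro rfl
    obtain rfl : e₁ = e₂ := Subtype.ext (he₁.trans he₂.symm)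
    simpa [hyz, hxy.symm] using hf₁.symm.trans hf₂
  have hac : a ≠ c := by
    rintro rfl
    obtain rfl : e₁ = e₃ := Subtype.ext (he₁.trans he₃.symm)
    simpa [hyz.symm, hxz.symm] using hf₁.symm.trans hf₃
  have hbc : b ≠ c := by
    rintro rfl
    obtain rfl : e₂ = e₃ := Subtype.ext (he₂.trans he₃.symm)
    simpa [hxy, hyz.symm] using hf₂.symm.trans hf₃
  have cases := edge_cases_of_claw_to_triangle hX φ hab hac hbc he₁ he₂ he₃ hxy hxz hyz hf₁ hf₂ hf₃
  have hV : ∀ u, u = v ∨ u = a ∨ u = b ∨ u = c := by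
    intro u
    obtain ⟨u', hu⟩ := hX₀ u
    have hmem : u ∈ s(u, u') := by simp
    rcases cases ⟨s(u, u'), hu⟩ with (e | e | e) | ⟨t, -, ⟨e, -⟩ | ⟨e, -⟩ | ⟨e, -⟩⟩
    · rw [show s(u, u') = _ from congrArg Subtype.val e, he₁, Sym2.mem_iff] at hmem
      rcases hmem with rfl | rfl <;> simp
    · rw [show s(u, u') = _ from congrArg Subtype.val e, he₂, Sym2.mem_iff] at hmem
      rcases hmem with rfl | rfl <;> simp
    · rw [show s(u, u') = _ from congrArg Subtype.val e, he₃, Sym2.mem_iff] at hmem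
      rcases hmem with rfl | rfl <;> simp
    all_goals
      rw [show s(u, u') = _ from e, Sym2.mem_iff] at hmem
      rcases hmem with rfl | rfl <;> simp
  -- An edge between two leaves is not a claw edge, so its image leaves the triangle.
  have hleaf : ∀ {p q}, (hpq : X.Adj p q) → v ≠ p → v ≠ q → ∃ t ∉ ({x, y, z} : Set W),
      (s(p, q) = s(a, b) ∧ Y.Adj z t) ∨ (s(p, q) = s(b, c) ∧ Y.Adj x t) ∨
      (s(p, q) = s(a, c) ∧ Y.Adj y t) := by
    intro p q hpq hp hq
    have hv : v ∉ s(p, q) := by simp [hp, hq]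
    rcases cases ⟨s(p, q), hpq⟩ with (e | e | e) | ⟨t, ht, h⟩
    · exact absurd (by rwa [← e] at h₁) hv
    · exact absurd (by rwa [← e] at h₂) hv
    · exact absurd (by rwa [← e] at h₃) hv
    · refine ⟨t, ht, h.imp (And.imp_right fun h => ?_)
        (Or.imp (And.imp_right fun h => ?_) (And.imp_right fun h => ?_))⟩ <;>
      rw [← mem_edgeSet, ← h] <;> exact Subtype.property _
  have hleaf_ab : X.Adj a b → ∃ t ∉ ({x, y, z} : Set W), Y.Adj z t := by
    intro hadj
    obtain ⟨t, ht, h⟩ := hleaf hadj hva.ne hvb.ne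
    exact ⟨t, ht, by simpa [hab, hac, hbc, hab.symm, hac.symm, hbc.symm] using h⟩
  have hleaf_bc : X.Adj b c → ∃ t ∉ ({x, y, z} : Set W), Y.Adj x t := by
    intro hadj
    obtain ⟨t, ht, h⟩ := hleaf hadj hvb.ne hvc.ne
    exact ⟨t, ht, by simpa [hab, hac, hbc, hab.symm, hac.symm, hbc.symm] using h⟩
  have hleaf_ac : X.Adj a c → ∃ t ∉ ({x, y, z} : Set W), Y.Adj y t := by
    intro hadj
    obtain ⟨t, ht, h⟩ := hleaf hadj hva.ne hvc.ne
    exact ⟨t, ht, by simpa [hab, hac, hbc, hab.symm, hac.symm, hbc.symm] using h⟩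
  -- The edges leaving the triangle come from edges between the leaves, one for each corner: it is
  -- the corner shared by the images of the claw edges that the edge meets.
  have hcorner : ∀ (e : X.edgeSet) p, p ∈ ({x, y, z} : Set W) → ∀ t ∉ ({x, y, z} : Set W),
      (φ e : Sym2 W) = s(p, t) → ((e : Sym2 V) = s(a, b) ∧ p = z) ∨
        ((e : Sym2 V) = s(b, c) ∧ p = x) ∨ ((e : Sym2 V) = s(a, c) ∧ p = y) := by
    intro e p hp t ht he
    have hpt : ∀ {p' t'}, t' ∉ ({x, y, z} : Set W) → (φ e : Sym2 W) = s(p', t') → p = p' := by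
      intro p' t' ht' h
      rcases Sym2.eq_iff.1 (he.symm.trans h) with h | h
      · exact h.1
      · exact absurd (h.1 ▸ hp) ht'
    have hside : ∀ {q r}, q ∈ ({x, y, z} : Set W) → r ∈ ({x, y, z} : Set W) →
        (φ e : Sym2 W) ≠ s(q, r) := by
      intro q r hq hr h
      have : t ∈ s(q, r) := by simp [← h, he]
      rcases Sym2.mem_iff.1 this with rfl | rfl
      exacts [ht hq, ht hr]
    rcases cases e with (rfl | rfl | rfl) | ⟨t', ht', ⟨e', h⟩ | ⟨e', h⟩ | ⟨e', h⟩⟩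
    · exact absurd hf₁ (hside (by simp) (by simp))
    · exact absurd hf₂ (hside (by simp) (by simp))
    · exact absurd hf₃ (hside (by simp) (by simp))
    · exact .inl ⟨e', hpt ht' h⟩
    · exact .inr (.inl ⟨e', hpt ht' h⟩)
    · exact .inr (.inr ⟨e', hpt ht' h⟩)
  have hpend : ∀ p ∈ ({x, y, z} : Set W), ∀ t ∉ ({x, y, z} : Set W), Y.Adj p t →
      (X.Adj a b ∧ p = z) ∨ (X.Adj b c ∧ p = x) ∨ (X.Adj a c ∧ p = y) := by
    intro p hp t ht h
    obtain ⟨e, he⟩ := φ.surjective ⟨s(p, t), h⟩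
    have he' := e.2
    rcases hcorner e p hp t ht (congrArg Subtype.val he) with h | h | h <;>
      rw [h.1, mem_edgeSet] at he'
    exacts [.inl ⟨he', h.2⟩, .inr (.inl ⟨he', h.2⟩), .inr (.inr ⟨he', h.2⟩)]
  -- All edges leaving the triangle have the same outer end.
  have huniq : ∀ p ∈ ({x, y, z} : Set W), ∀ q ∈ ({x, y, z} : Set W),
      ∀ t ∉ ({x, y, z} : Set W), ∀ t' ∉ ({x, y, z} : Set W), Y.Adj p t → Y.Adj q t' → t = t' := by
    intro p hp q hq t ht t' ht' h h'
    obtain ⟨e, he⟩ := φ.surjective ⟨s(p, t), h⟩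
    obtain ⟨e', he'⟩ := φ.surjective ⟨s(q, t'), h'⟩
    replace he : (φ e : Sym2 W) = s(p, t) := congrArg Subtype.val he
    replace he' : (φ e' : Sym2 W) = s(q, t') := congrArg Subtype.val he'
    -- Two edges between the leaves meet, hence so do their images.
    have hm : Meets s(p, t) s(q, t') := by
      rw [← he, ← he', meets_iso]
      rcases hcorner e p hp t ht he with ⟨hc, -⟩ | ⟨hc, -⟩ | ⟨hc, -⟩ <;>
        rcases hcorner e' q hq t' ht' he' with ⟨hc', -⟩ | ⟨hc', -⟩ | ⟨hc', -⟩ <;> simp [hc, hc']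
    have hpt' : p ≠ t' := fun h => ht' (h ▸ hp)
    have hqt : t ≠ q := fun h => ht (h ▸ hq)
    by_cases hpq : p = q
    · subst hpq
      have : e = e' := by
        apply Subtype.ext
        rcases hcorner e p hp t ht he with ⟨hc, h₁⟩ | ⟨hc, h₁⟩ | ⟨hc, h₁⟩ <;>
          rcases hcorner e' p hp t' ht' he' with ⟨hc', h₂⟩ | ⟨hc', h₂⟩ | ⟨hc', h₂⟩ <;>
          first
          | exact hc.trans hc'.symm
          | exact absurd (h₁.symm.trans h₂) (by assumption)
          | exact absurd (h₂.symm.trans h₁) (by assumption)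
      subst this
      simpa [hqt, hpt'] using he.symm.trans he'
    · exact (by simpa [Ne.symm hpq, hpt'.symm, hqt.symm] using hm : t' = t).symm
  have hW : ∀ u ∉ ({x, y, z} : Set W), ∃ p ∈ ({x, y, z} : Set W), Y.Adj p u := by
    intro u hu
    obtain ⟨u', hadj⟩ := hY₀ u
    refine ⟨u', ?_, hadj.symm⟩
    obtain ⟨e, he⟩ := φ.surjective ⟨s(u, u'), hadj⟩
    replace he : (φ e : Sym2 W) = s(u, u') := congrArg Subtype.val he
    have : ∃ p ∈ ({x, y, z} : Set W), p ∈ s(u, u') := by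
      rw [← he]
      rcases cases e with (rfl | rfl | rfl) | ⟨t', ht', ⟨e', h⟩ | ⟨e', h⟩ | ⟨e', h⟩⟩
      exacts [⟨y, by simp, by simp [hf₁]⟩, ⟨x, by simp, by simp [hf₂]⟩,
        ⟨x, by simp, by simp [hf₃]⟩, ⟨z, by simp, by simp [h]⟩, ⟨x, by simp, by simp [h]⟩,
        ⟨y, by simp, by simp [h]⟩]
    obtain ⟨p, hp, hpu⟩ := this
    rcases Sym2.mem_iff.1 hpu with rfl | rfl
    exacts [absurd hp hu, hp]
  by_cases hw : ∃ p ∈ ({x, y, z} : Set W), ∃ w ∉ ({x, y, z} : Set W), Y.Adj p w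
  · left
    obtain ⟨p, hp, w, hw, hpw⟩ := hw
    have hzw : X.Adj a b ↔ Y.Adj z w := by
      refine ⟨fun h => ?_, fun h => ?_⟩
      · obtain ⟨t, ht, h⟩ := hleaf_ab h
        rwa [← huniq _ (by simp) p hp t ht w hw h hpw]
      · simpa [hxz.symm, hyz.symm] using hpend z (by simp) w hw h
    have hxw : X.Adj b c ↔ Y.Adj x w := by
      refine ⟨fun h => ?_, fun h => ?_⟩
      · obtain ⟨t, ht, h⟩ := hleaf_bc h
        rwa [← huniq _ (by simp) p hp t ht w hw h hpw]
      · simpa [hxz, hxy] using hpend x (by simp) w hw h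
    have hyw : X.Adj a c ↔ Y.Adj y w := by
      refine ⟨fun h => ?_, fun h => ?_⟩
      · obtain ⟨t, ht, h⟩ := hleaf_ac h
        rwa [← huniq _ (by simp) p hp t ht w hw h hpw]
      · simpa [hxy.symm, hyz] using hpend y (by simp) w hw h
    have hW' : ∀ u, u = x ∨ u = y ∨ u = z ∨ u = w := by
      intro u
      by_cases hu : u ∈ ({x, y, z} : Set W)
      · simp only [Set.mem_insert_iff, Set.mem_singleton_iff] at hu
        exact hu.imp_right fun h => h.imp_right .inl
      · obtain ⟨q, hq, hqu⟩ := hW u hu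
        exact .inr (.inr (.inr (huniq q hq p hp u hu w hw hqu hpw)))
    simp only [Set.mem_insert_iff, Set.mem_singleton_iff, not_or] at hw
    exact nonempty_iso_of_claw_of_triangle hV hW' hab hac hbc hva hvb hvc hYxy hYxz hYyz hw.1 hw.2.1
      hw.2.2 hzw hxw hyw (by rcases hp with rfl | rfl | rfl <;> simp [hpw])
  · right
    push Not at hw
    have hnab : ¬ X.Adj a b := fun h => by
      obtain ⟨t, ht, h⟩ := hleaf_ab h
      exact hw _ (by simp) t ht h
    have hnbc : ¬ X.Adj b c := fun h => by
      obtain ⟨t, ht, h⟩ := hleaf_bc h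
      exact hw _ (by simp) t ht h
    have hnac : ¬ X.Adj a c := fun h => by
      obtain ⟨t, ht, h⟩ := hleaf_ac h
      exact hw _ (by simp) t ht h
    have hW' : ∀ u, u ∈ [x, y, z] := by
      intro u
      by_contra hu
      obtain ⟨p, hp, h⟩ := hW u (by simpa using hu)
      exact hw p hp u (by simpa using hu) h
    constructor
    · exact nonempty_iso_claw hV hab hac hbc hva hvb hvc hnab hnac hnbc
    · exact nonempty_iso_triangle hW' hYxy hYxz hYyz

/-! ### Line graph isomorphisms that preserve stars -/

/-- If three edges with a common vertex always have images with a common vertex, in both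
directions, then the star of a vertex of degree at least two is sent onto a star. -/
lemma exists_star_of_ne {V W : Type*} {X : SimpleGraph V} {Y : SimpleGraph W}
    (φ : X.lineGraph ≃g Y.lineGraph)
    (hφ : ∀ (v : V) (e₁ e₂ e₃ : X.edgeSet), v ∈ (e₁ : Sym2 V) → v ∈ (e₂ : Sym2 V) →
      v ∈ (e₃ : Sym2 V) → ∃ w, w ∈ (φ e₁ : Sym2 W) ∧ w ∈ (φ e₂ : Sym2 W) ∧ w ∈ (φ e₃ : Sym2 W))
    (hφ' : ∀ (w : W) (f₁ f₂ f₃ : Y.edgeSet), w ∈ (f₁ : Sym2 W) → w ∈ (f₂ : Sym2 W) →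
      w ∈ (f₃ : Sym2 W) → ∃ v, v ∈ (φ.symm f₁ : Sym2 V) ∧ v ∈ (φ.symm f₂ : Sym2 V) ∧
        v ∈ (φ.symm f₃ : Sym2 V))
    {v : V} {e f : X.edgeSet} (he : v ∈ (e : Sym2 V)) (hf : v ∈ (f : Sym2 V)) (hef : e ≠ f) :
    ∃ w, ∀ g : X.edgeSet, v ∈ (g : Sym2 V) ↔ w ∈ (φ g : Sym2 W) := by
  obtain ⟨w, hwe, hwf⟩ := (meets_iso φ e f).2 ⟨v, he, hf⟩
  have hne : (φ e : Sym2 W) ≠ φ f := fun h => hef (φ.injective (Subtype.ext h))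
  refine ⟨w, fun g => ⟨fun hg => ?_, fun hg => ?_⟩⟩
  · obtain ⟨w', h₁, h₂, h₃⟩ := hφ v e f g he hf hg
    rwa [eq_of_mem_of_mem hne hwe hwf h₁ h₂]
  · obtain ⟨v', h₁, h₂, h₃⟩ := hφ' w _ _ _ hwe hwf hg
    rw [φ.symm_apply_apply] at h₁ h₂ h₃
    rwa [eq_of_mem_of_mem (fun h => hef (Subtype.ext h)) he hf h₁ h₂]

/-- If the line graph is connected and there are at least two edges, then also the star of a vertex
of degree one is sent onto a star: its neighbour has degree at least two, and the star is sent to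
the other end of the image of the edge. -/
lemma exists_star {V W : Type*} {X : SimpleGraph V} {Y : SimpleGraph W}
    (hX₀ : ∀ u, ∃ u', X.Adj u u') (hX : X.lineGraph.Preconnected) (hX₁ : Nontrivial X.edgeSet)
    (φ : X.lineGraph ≃g Y.lineGraph)
    (hφ : ∀ (v : V) (e₁ e₂ e₃ : X.edgeSet), v ∈ (e₁ : Sym2 V) → v ∈ (e₂ : Sym2 V) →
      v ∈ (e₃ : Sym2 V) → ∃ w, w ∈ (φ e₁ : Sym2 W) ∧ w ∈ (φ e₂ : Sym2 W) ∧ w ∈ (φ e₃ : Sym2 W))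
    (hφ' : ∀ (w : W) (f₁ f₂ f₃ : Y.edgeSet), w ∈ (f₁ : Sym2 W) → w ∈ (f₂ : Sym2 W) →
      w ∈ (f₃ : Sym2 W) → ∃ v, v ∈ (φ.symm f₁ : Sym2 V) ∧ v ∈ (φ.symm f₂ : Sym2 V) ∧
        v ∈ (φ.symm f₃ : Sym2 V)) (v : V) :
    ∃ w, ∀ g : X.edgeSet, v ∈ (g : Sym2 V) ↔ w ∈ (φ g : Sym2 W) := by
  obtain ⟨u, hvu⟩ := hX₀ v
  set e : X.edgeSet := ⟨s(v, u), hvu⟩ with he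
  have hve : v ∈ (e : Sym2 V) := by simp [he]
  have hue : u ∈ (e : Sym2 V) := by simp [he]
  by_cases hdeg : ∃ f : X.edgeSet, v ∈ (f : Sym2 V) ∧ f ≠ e
  · obtain ⟨f, hf, hfe⟩ := hdeg
    exact exists_star_of_ne φ hφ hφ' hf hve hfe
  push Not at hdeg
  obtain ⟨g, hug, hge⟩ : ∃ g : X.edgeSet, u ∈ (g : Sym2 V) ∧ g ≠ e := by
    by_contra! h
    obtain ⟨f, hf⟩ := exists_ne e
    refine hf (edge_induction (P := (· = e)) hX e rfl ?_ f)
    rintro _ g rfl ⟨x, hx, hxg⟩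
    rcases Sym2.mem_iff.1 hx with rfl | rfl
    exacts [hdeg g hxg, h g hxg]
  obtain ⟨w₁, hw₁⟩ := exists_star_of_ne φ hφ hφ' hug hue hge
  obtain ⟨w₂, hw₂⟩ := Sym2.mem_iff_exists.1 ((hw₁ e).1 hue)
  have hw : w₁ ≠ w₂ := by
    have := (φ e).2
    rw [hw₂, mem_edgeSet] at this
    exact this.ne
  refine ⟨w₂, fun g => ⟨fun h => ?_, fun h => ?_⟩⟩
  · rw [hdeg g h, hw₂]
    simp
  · obtain ⟨x, hx, hxg⟩ := (meets_iso φ e g).1 ⟨w₂, by simp [hw₂], h⟩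
    rcases Sym2.mem_iff.1 hx with rfl | rfl
    · exact hxg
    · have : (φ g : Sym2 W) = φ e :=
        ((Sym2.mem_and_mem_iff hw).1 ⟨(hw₁ g).1 hxg, h⟩).trans hw₂.symm
      rwa [φ.injective (Subtype.ext this)]

/-- If the line graph is connected and has at least two vertices, a vertex is determined by its
star: two vertices with the same star would be the ends of an edge that meets no other edge. -/
lemma eq_of_star_eq {V : Type*} {X : SimpleGraph V} (hX₀ : ∀ u, ∃ u', X.Adj u u')
    (hX : X.lineGraph.Preconnected) (hX₁ : Nontrivial X.edgeSet) {v v' : V}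
    (h : ∀ g : X.edgeSet, v ∈ (g : Sym2 V) ↔ v' ∈ (g : Sym2 V)) : v = v' := by
  by_contra hne
  obtain ⟨u, hvu⟩ := hX₀ v
  set e : X.edgeSet := ⟨s(v, u), hvu⟩ with he
  have hve : v ∈ (e : Sym2 V) := by simp [he]
  have hev : (e : Sym2 V) = s(v, v') := (Sym2.mem_and_mem_iff hne).1 ⟨hve, (h e).1 hve⟩
  obtain ⟨f, hf⟩ := exists_ne e
  refine hf (edge_induction (P := (· = e)) hX e rfl ?_ f)
  rintro _ g rfl ⟨x, hx, hxg⟩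
  rw [hev, Sym2.mem_iff] at hx
  have hvg : v ∈ (g : Sym2 V) := by
    rcases hx with rfl | rfl
    exacts [hxg, (h g).2 hxg]
  exact Subtype.ext (((Sym2.mem_and_mem_iff hne).1 ⟨hvg, (h g).1 hvg⟩).trans hev.symm)

lemma nonempty_iso_of_preserves_claws {V W : Type*} {X : SimpleGraph V} {Y : SimpleGraph W}
    (hX₀ : ∀ u, ∃ u', X.Adj u u') (hY₀ : ∀ u, ∃ u', Y.Adj u u') (hX : X.lineGraph.Preconnected)
    (hX₁ : Nontrivial X.edgeSet) (φ : X.lineGraph ≃g Y.lineGraph)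
    (hφ : ∀ (v : V) (e₁ e₂ e₃ : X.edgeSet), v ∈ (e₁ : Sym2 V) → v ∈ (e₂ : Sym2 V) →
      v ∈ (e₃ : Sym2 V) → ∃ w, w ∈ (φ e₁ : Sym2 W) ∧ w ∈ (φ e₂ : Sym2 W) ∧ w ∈ (φ e₃ : Sym2 W))
    (hφ' : ∀ (w : W) (f₁ f₂ f₃ : Y.edgeSet), w ∈ (f₁ : Sym2 W) → w ∈ (f₂ : Sym2 W) →
      w ∈ (f₃ : Sym2 W) → ∃ v, v ∈ (φ.symm f₁ : Sym2 V) ∧ v ∈ (φ.symm f₂ : Sym2 V) ∧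
        v ∈ (φ.symm f₃ : Sym2 V)) : Nonempty (X ≃g Y) := by
  have hY : Y.lineGraph.Preconnected := φ.preconnected_iff.1 hX
  have hY₁ : Nontrivial Y.edgeSet := φ.symm.toEquiv.nontrivial
  choose f hf using exists_star hX₀ hX hX₁ φ hφ hφ'
  have hinj : f.Injective := fun v v' h => eq_of_star_eq hX₀ hX hX₁ fun g => by rw [hf, hf, h]
  have hsurj : f.Surjective := by
    intro w
    obtain ⟨v, hv⟩ := exists_star hY₀ hY hY₁ φ.symm hφ' hφ w
    refine ⟨v, eq_of_star_eq hY₀ hY hY₁ fun g => ?_⟩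
    rw [hv, hf, φ.apply_symm_apply]
  refine nonempty_iso_of_bijective Function.bijective_id ⟨hinj, hsurj⟩ fun v v' => ?_
  by_cases hvv : v = v'
  · simp [hvv]
  constructor
  · intro h
    have hg := (Sym2.mem_and_mem_iff (hinj.ne hvv)).1
      ⟨(hf v ⟨s(v, v'), h⟩).1 (by simp), (hf v' ⟨s(v, v'), h⟩).1 (by simp)⟩
    rw [← mem_edgeSet, ← hg]
    exact Subtype.property _
  · intro h
    obtain ⟨g, hg⟩ := φ.surjective ⟨s(f v, f v'), h⟩
    replace hg : (φ g : Sym2 W) = s(f v, f v') := congrArg Subtype.val hg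
    have hg' := (Sym2.mem_and_mem_iff hvv).1
      ⟨(hf v g).2 (by simp [hg]), (hf v' g).2 (by simp [hg])⟩
    rw [id, id, ← mem_edgeSet, ← hg']
    exact g.2

lemma nonempty_iso_of_subsingleton_edgeSet {V : Type*} {X : SimpleGraph V}
    (hX₀ : ∀ u, ∃ u', X.Adj u u') (hne : Nonempty X.edgeSet) (hX₁ : Subsingleton X.edgeSet) :
    Nonempty (X ≃g (⊤ : SimpleGraph (Fin 2))) := by
  obtain ⟨⟨e, he⟩⟩ := hne
  induction e with
  | _ x y =>
    refine nonempty_iso_edge (fun u => ?_) he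
    obtain ⟨u', hu⟩ := hX₀ u
    have h : s(u, u') = s(x, y) := congrArg Subtype.val (hX₁.elim ⟨s(u, u'), hu⟩ ⟨s(x, y), he⟩)
    rw [← Sym2.mem_iff, ← h]
    simp

/-- **Whitney's theorem**: a graph without isolated vertices whose line graph is connected is
determined by its line graph, unless it is the claw or the triangle. -/
theorem nonempty_iso_of_lineGraph_iso {V W : Type*} {X : SimpleGraph V} {Y : SimpleGraph W}
    (hX₀ : ∀ u, ∃ u', X.Adj u u') (hY₀ : ∀ u, ∃ u', Y.Adj u u') (hX : X.lineGraph.Connected)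
    (φ : X.lineGraph ≃g Y.lineGraph)
    (hclaw : ¬ Nonempty (X ≃g completeBipartiteGraph (Fin 1) (Fin 3)))
    (htriangle : ¬ Nonempty (X ≃g (⊤ : SimpleGraph (Fin 3)))) : Nonempty (X ≃g Y) := by
  have hY : Y.lineGraph.Connected := φ.connected_iff.1 hX
  rcases subsingleton_or_nontrivial X.edgeSet with hX₁ | hX₁
  · obtain ⟨α⟩ := nonempty_iso_of_subsingleton_edgeSet hX₀ hX.nonempty hX₁
    obtain ⟨β⟩ := nonempty_iso_of_subsingleton_edgeSet hY₀ hY.nonempty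
      φ.symm.toEquiv.subsingleton
    exact ⟨α.trans β.symm⟩
  · by_contra hXY
    refine hXY (nonempty_iso_of_preserves_claws hX₀ hY₀ hX.preconnected hX₁ φ ?_ ?_)
    · intro v e₁ e₂ e₃ h₁ h₂ h₃
      by_contra h
      rcases nonempty_iso_or_claw_of_claw_to_triangle hX₀ hY₀ hX.preconnected φ h₁ h₂ h₃ h with
        h | h
      exacts [hXY h, hclaw h.1]
    · intro w f₁ f₂ f₃ h₁ h₂ h₃
      by_contra h
      rcases nonempty_iso_or_claw_of_claw_to_triangle hY₀ hX₀ hY.preconnected φ.symm h₁ h₂ h₃ h with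
        h | h
      exacts [hXY (h.map Iso.symm), htriangle h.2]

/-! ### Token jumping with two tokens -/

/-- Two tokens on independent vertices form an edge of the complement, and a jump replaces an edge
by another one that shares a vertex with it. -/
lemma nonempty_tokenJumpingGraph_iso_lineGraph {V : Type*} (G : SimpleGraph V) :
    Nonempty (tokenJumpingGraph 2 G ≃g Gᶜ.lineGraph) := by
  classical
  have hind : ∀ e : Gᶜ.edgeSet, G.IsNIndepSet 2 (e : Sym2 V).toFinset := by
    rintro ⟨e, he⟩
    refine ⟨fun x hx y hy hxy => ?_, Sym2.card_toFinset_of_not_isDiag e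
      (Gᶜ.not_isDiag_of_mem_edgeSet he)⟩
    simp only [Finset.mem_coe, Sym2.mem_toFinset] at hx hy
    rw [(Sym2.mem_and_mem_iff hxy).1 ⟨hx, hy⟩] at he
    exact he.2
  refine nonempty_iso_of_bijective (α := fun e => ⟨_, hind e⟩) ⟨fun e f h => ?_, fun I => ?_⟩
    Function.bijective_id fun e f => ?_
  · refine Subtype.ext (Sym2.ext fun x => ?_)
    rw [← Sym2.mem_toFinset, show (e : Sym2 V).toFinset = (f : Sym2 V).toFinset from
      congrArg Subtype.val h, Sym2.mem_toFinset]
  · obtain ⟨I, hI⟩ := I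
    obtain ⟨x, y, hxy, rfl⟩ := Finset.card_eq_two.1 hI.card_eq
    refine ⟨⟨s(x, y), hxy, hI.isIndepSet (by simp) (by simp) hxy⟩, Subtype.ext ?_⟩
    ext z
    simp
  · rw [id, id, lineGraph_adj_iff_exists]
    constructor
    · rintro ⟨u, hu, v, hv, h⟩
      simp only [Sym2.mem_toFinset] at hu hv
      have mem : ∀ x, x ∈ (f : Sym2 V) ↔ x = v ∨ (x ∈ (e : Sym2 V) ∧ x ≠ u) := fun x => by
        simpa using Set.ext_iff.1 h x
      obtain ⟨w, hw⟩ := Sym2.mem_iff_exists.1 hu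
      have hwe : w ∈ (e : Sym2 V) := by simp [hw]
      have huw : w ≠ u := by
        have := e.2
        rw [hw, mem_edgeSet] at this
        exact this.ne'
      exact ⟨fun hef => hv (hef ▸ (mem v).2 (.inl rfl)), w, hwe, (mem w).2 (.inr ⟨hwe, huw⟩)⟩
    · rintro ⟨hne, w, hwe, hwf⟩
      obtain ⟨u, hu⟩ := Sym2.mem_iff_exists.1 hwe
      obtain ⟨v, hv⟩ := Sym2.mem_iff_exists.1 hwf
      have hwu : w ≠ u := by
        have := e.2
        rw [hu, mem_edgeSet] at this
        exact this.ne
      have hwv : w ≠ v := by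
        have := f.2
        rw [hv, mem_edgeSet] at this
        exact this.ne
      have huv : v ≠ u := by
        rintro rfl
        exact hne (Subtype.ext (hu.trans hv.symm))
      refine ⟨u, by simp [hu], v, by simp [hu, huv, hwv.symm], ?_⟩
      ext x
      simp only [Finset.mem_coe, Sym2.mem_toFinset, hu, hv, Sym2.mem_iff, Set.mem_insert_iff,
        Set.mem_sdiff, Set.mem_singleton_iff]
      constructor
      · rintro (rfl | rfl)
        exacts [.inr ⟨.inl rfl, hwu⟩, .inl rfl]
      · rintro (rfl | ⟨rfl | rfl, h⟩)
        exacts [.inr rfl, .inl rfl, absurd rfl h]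

/-- In a join `A + B`, a non-neighbour of a vertex of `A` lies in `A` too. -/
lemma joinFactorsHaveIndepSets_two_of_compl_adj {V : Type*} {G : SimpleGraph V}
    (h : ∀ u, ∃ u', Gᶜ.Adj u u') : JoinFactorsHaveIndepSets 2 G := by
  classical
  have key : ∀ A B : Set V, A.Nonempty → IsCompl A B → (∀ a ∈ A, ∀ b ∈ B, G.Adj a b) →
      ∃ I : Finset V, (I : Set V) ⊆ A ∧ G.IsNIndepSet 2 I := by
    rintro A B ⟨a, ha⟩ hAB hadj
    obtain ⟨u, hau, hu⟩ := h a
    have huA : u ∈ A := by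
      by_contra huA
      exact hu (hadj a ha u (hAB.compl_eq ▸ huA))
    refine ⟨{a, u}, by simp [Set.insert_subset_iff, ha, huA], ?_, Finset.card_pair hau⟩
    intro x hx y hy hxy
    simp only [Finset.coe_insert, Finset.coe_singleton, Set.mem_insert_iff,
      Set.mem_singleton_iff] at hx hy
    rcases hx with rfl | rfl <;> rcases hy with rfl | rfl
    exacts [absurd rfl hxy, hu, fun h => hu h.symm, absurd rfl hxy]
  exact fun A B hA hB hAB hadj => ⟨key A B hA hAB hadj,
    key B A hB hAB.symm fun b hb a ha => (hadj a ha b hb).symm⟩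

/-- A vertex adjacent to all others would be a join factor without an independent pair. The complement
needs an edge, since the one-vertex graph satisfies the condition vacuously. -/
lemma exists_compl_adj_of_joinFactorsHaveIndepSets_two {V : Type*} {G : SimpleGraph V}
    (h : JoinFactorsHaveIndepSets 2 G) (hne : Nonempty Gᶜ.edgeSet) (u : V) :
    ∃ u', Gᶜ.Adj u u' := by
  by_contra! hu
  obtain ⟨⟨e, he⟩⟩ := hne
  induction e with
  | _ x y =>
    have hB : ({u}ᶜ : Set V).Nonempty := by
      by_cases hx : x = u
      · exact ⟨y, fun hy => he.1 (hx.trans hy.symm)⟩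
      · exact ⟨x, hx⟩
    obtain ⟨⟨I, hI, hI'⟩, -⟩ := h {u} {u}ᶜ (Set.singleton_nonempty u) hB isCompl_compl (by
      rintro a rfl b hb
      by_contra hab
      exact hu b ⟨fun h => hb h.symm, hab⟩)
    have hcard := Finset.card_le_card (Finset.coe_subset.1 (by simpa using hI) : I ⊆ {u})
    rw [hI'.card_eq, Finset.card_singleton] at hcard
    omega

lemma nonempty_lineGraph_iso_of_forall_meets {V : Type*} {X : SimpleGraph V} [Fintype X.edgeSet]
    (h : ∀ e f : X.edgeSet, ∃ u, u ∈ (e : Sym2 V) ∧ u ∈ (f : Sym2 V))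
    (hcard : Fintype.card X.edgeSet = 3) :
    Nonempty (X.lineGraph ≃g (⊤ : SimpleGraph (Fin 3))) :=
  nonempty_iso_of_bijective Function.bijective_id (Fintype.equivFinOfCardEq hcard).bijective
    fun e f => by simp [lineGraph_adj_iff_exists, h e f]

lemma nonempty_lineGraph_triangle_iso :
    Nonempty ((⊤ : SimpleGraph (Fin 3)).lineGraph ≃g (⊤ : SimpleGraph (Fin 3))) :=
  nonempty_lineGraph_iso_of_forall_meets (by decide) (by decide)

instance decidableRelCompleteBipartiteGraphAdj {V W : Type*} :
    DecidableRel (completeBipartiteGraph V W).Adj := fun v w =>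
  inferInstanceAs (Decidable (v.isLeft ∧ w.isRight ∨ v.isRight ∧ w.isLeft))

lemma nonempty_lineGraph_claw_iso :
    Nonempty ((completeBipartiteGraph (Fin 1) (Fin 3)).lineGraph ≃g (⊤ : SimpleGraph (Fin 3))) :=
  nonempty_lineGraph_iso_of_forall_meets (by decide) (by decide)

lemma compl_iso {V W : Type*} {X : SimpleGraph V} {Y : SimpleGraph W} (f : X ≃g Y) :
    Nonempty (Xᶜ ≃g Yᶜ) :=
  nonempty_iso_of_bijective Function.bijective_id f.bijective fun i j => by
    simp [compl_adj, f.map_adj_iff, f.injective.eq_iff]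

theorem mainTheorem7 {V : Type*} [Finite V] (G : SimpleGraph V)
    (hjoin : JoinFactorsHaveIndepSets 2 G) (hconn : (tokenJumpingGraph 2 G).Connected) :
    DeterminedByTokenJumpingGraph 2 G ↔
      ¬ (Nonempty (tokenJumpingGraph 2 G ≃g (⊤ : SimpleGraph (Fin 3))) ∧
          (Nonempty (Gᶜ ≃g (⊤ : SimpleGraph (Fin 3))) ∨
            Nonempty (Gᶜ ≃g completeBipartiteGraph (Fin 1) (Fin 3)))) := by
  obtain ⟨α⟩ := nonempty_tokenJumpingGraph_iso_lineGraph G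
  have hL : Gᶜ.lineGraph.Connected := α.connected_iff.1 hconn
  obtain ⟨τ⟩ := nonempty_lineGraph_triangle_iso
  obtain ⟨κ⟩ := nonempty_lineGraph_claw_iso
  constructor
  · rintro hdet ⟨⟨γ⟩, hG⟩
    -- The triangle and the claw have the same line graph, so both would be the complement of `G`.
    have hdet' : ∀ {U : Type} [Finite U] (K : SimpleGraph U), (∀ u, ∃ u', K.Adj u u') →
        K.lineGraph ≃g (⊤ : SimpleGraph (Fin 3)) → Nonempty (K ≃g Gᶜ) := by
      intro U _ K hK κ
      obtain ⟨β⟩ := nonempty_tokenJumpingGraph_iso_lineGraph Kᶜ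
      rw [compl_compl] at β
      obtain ⟨f⟩ := hdet U Kᶜ (joinFactorsHaveIndepSets_two_of_compl_adj (by rwa [compl_compl]))
        ⟨β.trans (κ.trans γ.symm)⟩
      simpa only [compl_compl] using compl_iso f
    obtain ⟨f⟩ := hdet' (⊤ : SimpleGraph (Fin 3)) (by decide) τ
    obtain ⟨g⟩ := hdet' (completeBipartiteGraph (Fin 1) (Fin 3)) (by simp) κ
    simpa using Nat.card_congr (f.trans g.symm).toEquiv
  · intro hG W _ H hH ⟨φ⟩
    obtain ⟨β⟩ := nonempty_tokenJumpingGraph_iso_lineGraph H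
    have ψ : Gᶜ.lineGraph ≃g Hᶜ.lineGraph := α.symm.trans (φ.symm.trans β)
    obtain ⟨f⟩ := nonempty_iso_of_lineGraph_iso
      (exists_compl_adj_of_joinFactorsHaveIndepSets_two hjoin hL.nonempty)
      (exists_compl_adj_of_joinFactorsHaveIndepSets_two hH (ψ.connected_iff.1 hL).nonempty) hL ψ
      (fun ⟨f⟩ => hG ⟨⟨α.trans (f.lineGraph.trans κ)⟩, .inr ⟨f⟩⟩)
      (fun ⟨f⟩ => hG ⟨⟨α.trans (f.lineGraph.trans τ)⟩, .inl ⟨f⟩⟩)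
    simpa only [compl_compl] using compl_iso f.symm
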